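/- Let $k$ be a commutative ring and let $\mathcal{A}=(A=\bigoplus_{i\in\mathbb{Z}}A^i,d)$ be a differential graded (associative, unital) $k$-algebra such that $A^i=0$ for $i<0$, the ring $A^0$ is semisimple, and $d(A^0)=0$. Let $\mathrm{dgMod}(\mathcal{A})$ be the category of dg right $\mathcal{A}$-modules, with morphisms the $A$-linear maps of degree $0$ that commute with the differentials. For $l\in\mathbb{Z}$ the shift $\{l\}M$ of a dg module $M$ is given by $(\{l\}M)^i=M^{i+l}$ and $d_{\{l\}M}=(-1)^l d_M$. For a simple right $A^0$-module $L$, let $\hat L=L\otimes_{A^0}A$ be the dg module with $\hat L^i=L\otimes_{A^0}A^i$ and differential $\mathrm{id}_L\otimes d$. Let $\mathrm{dgFilt}(\mathcal{A})$ be the class of dg modules $M$ that admit a finite filtration $0=F_0(M)\subset F_1(M)\subset\dots\subset F_n(M)=M$ by dg submodules with $F_i(M)/F_{i-1}(M)\cong\{l_i\}\hat L_i$ in $\mathrm{dgMod}(\mathcal{A})$ for suitable simple right $A^0$-modules $L_i$ and integers $l_1\geq l_2\geq\dots\geq l_n$. Proposition (Fitting decomposition). Let $M$ be in $\mathrm{dgFilt}(\mathcal{A})$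 and let $f:M\to M$ be an endomorphism in $\mathrm{dgMod}(\mathcal{A})$. Then there is an $N\in\mathbb{N}$ such that for all $n\geq N$ $$\ker f^n=\ker f^{n+1},\qquad \operatorname{im} f^n=\operatorname{im} f^{n+1},\qquad M=\ker f^n\oplus\operatorname{im} f^n,$$ the last being a direct sum decomposition of dg modules. -/

import Mathlib

open scoped TensorProduct

universe uk u w w₁ w₂ w₃

/-- A differential on a `ℤ`-graded associative unital `k`-algebra `A = ⨁ 𝒜 i`, making it a
dg algebra: a `k`-linear map of degree `1` with square zero and the graded Leibniz rule
`d (a b) = (d a) b + (-1)^{|a|} a (d b)`. -/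
structure DGAlgebra {k : Type uk} [CommRing k] {A : Type u} [Ring A] [Algebra k A]
    (𝒜 : ℤ → Submodule k A) [GradedAlgebra 𝒜] where
  d : A →ₗ[k] A
  d_mem : ∀ {i : ℤ} {a : A}, a ∈ 𝒜 i → d a ∈ 𝒜 (i + 1)
  d_d : ∀ a : A, d (d a) = 0
  leibniz : ∀ {i : ℤ} {a : A}, a ∈ 𝒜 i → ∀ b : A,
    d (a * b) = d a * b + i.negOnePow • (a * d b)

namespace DGAlgebra

variable {k : Type uk} [CommRing k] {A : Type u} [Ring A] [Algebra k A]
  {𝒜 : ℤ → Submodule k A} [GradedAlgebra 𝒜]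

/-- The standing assumptions on the dg algebra: it is positively graded, its degree zero part
is a semisimple ring, and the differential vanishes on the degree zero part. -/
structure IsAdmissible (D : DGAlgebra 𝒜) : Prop where
  pos_graded : ∀ i : ℤ, i < 0 → 𝒜 i = ⊥
  semisimple : IsSemisimpleRing (𝒜 0)
  d_zero : ∀ a ∈ 𝒜 0, D.d a = 0

/-- Multiplication of homogeneous elements, `A^i × A^j → A^n` for `i + j = n`. -/
def gmul (_D : DGAlgebra 𝒜) {i j n : ℤ} (h : i + j = n) (a : 𝒜 i) (b : 𝒜 j) : 𝒜 n :=
  ⟨a.1 * b.1, h ▸ SetLike.mul_mem_graded a.2 b.2⟩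

/-- The differential on homogeneous elements, `A^i → A^j` for `i + 1 = j`. -/
def gd (D : DGAlgebra 𝒜) {i j : ℤ} (h : i + 1 = j) (a : 𝒜 i) : 𝒜 j :=
  ⟨D.d a.1, h ▸ D.d_mem a.2⟩

end DGAlgebra

/-- A dg (right) module over the dg algebra `D`, given by its homogeneous components `M^i`, the
actions `M^i × A^j → M^{i+j}` and the differentials `M^i → M^{i+1}`. The indices of the targets
are variables subject to an equation. The `k`-module structure on `M^i` is the one
induced by the action of `k → A^0`; the action and the differential are then `k`-linear. -/
structure DGModule {k : Type uk} [CommRing k] {A : Type u} [Ring A] [Algebra k A]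
    {𝒜 : ℤ → Submodule k A} [GradedAlgebra 𝒜] (D : DGAlgebra 𝒜) where
  X : ℤ → Type w
  [grp : ∀ i, AddCommGroup (X i)]
  act : ∀ {i j n : ℤ}, i + j = n → X i →+ 𝒜 j →+ X n
  act_one : ∀ {i : ℤ} (x : X i), act (add_zero i) x ⟨1, SetLike.one_mem_graded 𝒜⟩ = x
  act_act : ∀ {i j l p q n : ℤ} (h₁ : i + j = p) (h₂ : p + l = n) (h₃ : j + l = q)
    (h₄ : i + q = n) (x : X i) (a : 𝒜 j) (b : 𝒜 l),
    act h₂ (act h₁ x a) b = act h₄ x (D.gmul h₃ a b)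
  d : ∀ {i j : ℤ}, i + 1 = j → X i →+ X j
  d_d : ∀ {i j l : ℤ} (h₁ : i + 1 = j) (h₂ : j + 1 = l) (x : X i), d h₂ (d h₁ x) = 0
  leibniz : ∀ {i j n i' j' n' : ℤ} (h : i + j = n) (hi : i + 1 = i') (hj : j + 1 = j')
    (hn : n + 1 = n') (h₁ : i' + j = n') (h₂ : i + j' = n') (x : X i) (a : 𝒜 j),
    d hn (act h x a) = act h₁ (d hi x) a + i.negOnePow • act h₂ x (D.gd hj a)

namespace DGModule

attribute [instance] DGModule.grp

variable {k : Type uk} [CommRing k] {A : Type u} [Ring A] [Algebra k A]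
  {𝒜 : ℤ → Submodule k A} [GradedAlgebra 𝒜] {D : DGAlgebra 𝒜}

/-- Morphisms in the category of dg modules: maps of degree `0` that commute with the action
and the differential. -/
@[ext]
structure Hom (M : DGModule.{uk, u, w₁} D) (N : DGModule.{uk, u, w₂} D) where
  toFun : ∀ i, M.X i →+ N.X i
  map_act : ∀ {i j n : ℤ} (h : i + j = n) (x : M.X i) (a : 𝒜 j),
    toFun n (M.act h x a) = N.act h (toFun i x) a
  map_d : ∀ {i j : ℤ} (h : i + 1 = j) (x : M.X i), toFun j (M.d h x) = N.d h (toFun i x)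

/-- The identity morphism. -/
def Hom.id (M : DGModule.{uk, u, w} D) : Hom M M where
  toFun i := AddMonoidHom.id (M.X i)
  map_act _ _ _ := rfl
  map_d _ _ := rfl

/-- Composition of morphisms, `g ∘ f`. -/
def Hom.comp {M : DGModule.{uk, u, w₁} D} {N : DGModule.{uk, u, w₂} D}
    {P : DGModule.{uk, u, w₃} D} (g : Hom N P) (f : Hom M N) : Hom M P where
  toFun i := (g.toFun i).comp (f.toFun i)
  map_act h x a := by simp [f.map_act, g.map_act]
  map_d h x := by simp [f.map_d, g.map_d]

/-- Endomorphisms of a dg module form a monoid under composition; this gives meaning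
to the powers `f ^ n`. -/
instance (M : DGModule.{uk, u, w} D) : Monoid (Hom M M) where
  one := Hom.id M
  mul g f := g.comp f
  mul_assoc _ _ _ := rfl
  one_mul _ := rfl
  mul_one _ := rfl

/-- Isomorphisms of dg modules (possibly in different universes). -/
structure Iso (M : DGModule.{uk, u, w₁} D) (N : DGModule.{uk, u, w₂} D) where
  hom : Hom M N
  inv : Hom N M
  hom_inv_id : inv.comp hom = Hom.id M
  inv_hom_id : hom.comp inv = Hom.id N

/-- The shift `{l} M`, with `({l} M)^i = M^{i+l}` and differential `(-1)^l d`. -/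
def shift (l : ℤ) (M : DGModule.{uk, u, w} D) : DGModule.{uk, u, w} D where
  X i := M.X (i + l)
  act {i j n} h := M.act (i := i + l) (j := j) (n := n + l) (by omega)
  act_one {i} x := by
    have key : ∀ {n : ℤ} (h : i + l + 0 = n) (h' : n = i + l),
        M.act h x ⟨1, SetLike.one_mem_graded 𝒜⟩ = h' ▸ x := by
      intro n h h'
      subst h'
      exact M.act_one x
    exact key _ rfl
  act_act _ _ h₃ _ x a b := M.act_act _ _ h₃ _ x a b
  d {i j} h := l.negOnePow • M.d (i := i + l) (j := j + l) (by omega)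
  d_d h₁ h₂ x := by
    simp only [AddMonoidHom.smul_apply, Units.smul_def, map_zsmul, M.d_d, smul_zero]
  leibniz {i j n i' j' n'} h hi hj hn h₁ h₂ x a := by
    have hs : l.negOnePow * (i + l).negOnePow = i.negOnePow := by
      rw [Int.negOnePow_add, mul_comm, mul_assoc, Int.units_mul_self, mul_one]
    simp only [AddMonoidHom.smul_apply]
    rw [M.leibniz (i := i + l) (j := j) (n := n + l) (i' := i' + l) (j' := j') (n' := n' + l)
      (by omega) (by omega) hj (by omega) (by omega) (by omega) x a,
      smul_add, smul_smul, hs]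
    congr 1
    simp only [Units.smul_def, map_zsmul, AddMonoidHom.smul_apply]

/-- A dg submodule: subgroups `U^i ⊆ M^i` stable under the action and the differential. -/
@[ext]
structure Sub (M : DGModule.{uk, u, w} D) where
  carrier : ∀ i, AddSubgroup (M.X i)
  act_mem : ∀ {i j n : ℤ} (h : i + j = n) {x : M.X i} (a : 𝒜 j),
    x ∈ carrier i → M.act h x a ∈ carrier n
  d_mem : ∀ {i j : ℤ} (h : i + 1 = j) {x : M.X i}, x ∈ carrier i → M.d h x ∈ carrier j

namespace Sub

/-- Inclusion of dg submodules. -/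
instance (M : DGModule.{uk, u, w} D) : PartialOrder (Sub M) :=
  PartialOrder.lift Sub.carrier (fun _ _ h => Sub.ext h)

/-- The zero submodule and the whole module. -/
instance (M : DGModule.{uk, u, w} D) : BoundedOrder (Sub M) where
  bot := { carrier := fun _ => ⊥
           act_mem := by
             intro i j n h x a hx
             rw [AddSubgroup.mem_bot] at hx ⊢
             simp [hx]
           d_mem := by
             intro i j h x hx
             rw [AddSubgroup.mem_bot] at hx ⊢
             simp [hx] }
  bot_le U := fun i => (bot_le : ⊥ ≤ U.carrier i)
  top := { carrier := fun _ => ⊤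
           act_mem := fun _ _ _ _ => AddSubgroup.mem_top _
           d_mem := fun _ _ _ => AddSubgroup.mem_top _ }
  le_top U := fun i => (le_top : U.carrier i ≤ ⊤)

/-- `M = U ⊕ V` (internal direct sum of dg submodules): in each degree, `M^i = U^i ⊕ V^i`. -/
def IsDirectSum {M : DGModule.{uk, u, w} D} (U V : Sub M) : Prop :=
  ∀ i, IsCompl (U.carrier i) (V.carrier i)

/-- A dg submodule, viewed as a dg module. -/
def toDGModule {M : DGModule.{uk, u, w} D} (U : Sub M) : DGModule.{uk, u, w} D where
  X i := U.carrier i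
  act {i j n} h := AddMonoidHom.mk' (fun x => AddMonoidHom.mk'
      (fun a => (⟨M.act h x.1 a, U.act_mem h a x.2⟩ : U.carrier n))
      (fun a b => Subtype.ext (by simp)))
    (fun x y => AddMonoidHom.ext fun a => Subtype.ext (by simp))
  act_one x := Subtype.ext (M.act_one x.1)
  act_act h₁ h₂ h₃ h₄ x a b := Subtype.ext (M.act_act h₁ h₂ h₃ h₄ x.1 a b)
  d {i j} h := AddMonoidHom.mk'
    (fun x => (⟨M.d h x.1, U.d_mem h x.2⟩ : U.carrier j)) (fun x y => Subtype.ext (by simp))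
  d_d h₁ h₂ x := Subtype.ext (M.d_d h₁ h₂ x.1)
  leibniz h hi hj hn h₁ h₂ x a := Subtype.ext (by
    simpa [Units.smul_def] using M.leibniz h hi hj hn h₁ h₂ x.1 a)

/-- The quotient dg module `M / U`. -/
def quotient {M : DGModule.{uk, u, w} D} (U : Sub M) : DGModule.{uk, u, w} D where
  X i := M.X i ⧸ U.carrier i
  act {i j n} h := QuotientAddGroup.lift (U.carrier i)
    (AddMonoidHom.mk' (fun x => (QuotientAddGroup.mk' (U.carrier n)).comp (M.act h x))
      (fun x y => AddMonoidHom.ext fun a => by simp))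
    (fun x hx => AddMonoidHom.ext fun a =>
      (QuotientAddGroup.eq_zero_iff _).2 (U.act_mem h a hx))
  act_one x := by
    induction x using QuotientAddGroup.induction_on with
    | H x => exact congrArg (QuotientAddGroup.mk' _) (M.act_one x)
  act_act h₁ h₂ h₃ h₄ x a b := by
    induction x using QuotientAddGroup.induction_on with
    | H x => exact congrArg (QuotientAddGroup.mk' _) (M.act_act h₁ h₂ h₃ h₄ x a b)
  d {i j} h := QuotientAddGroup.map (U.carrier i) (U.carrier j) (M.d h)
    (fun _ hx => U.d_mem h hx)
  d_d h₁ h₂ x := by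
    induction x using QuotientAddGroup.induction_on with
    | H x => exact congrArg (QuotientAddGroup.mk' _) (M.d_d h₁ h₂ x)
  leibniz h hi hj hn h₁ h₂ x a := by
    induction x using QuotientAddGroup.induction_on with
    | H x => exact congrArg (QuotientAddGroup.mk' _) (M.leibniz h hi hj hn h₁ h₂ x a)

/-- For dg submodules `U, V` of `M`, the dg submodule `U ∩ V` of the dg module `V`. -/
def restrict {M : DGModule.{uk, u, w} D} (U V : Sub M) : Sub V.toDGModule where
  carrier i := (U.carrier i).addSubgroupOf (V.carrier i)
  act_mem h _ a hx := U.act_mem h a hx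
  d_mem h _ hx := U.d_mem h hx

/-- The subquotient `V / U` for dg submodules `U ⊆ V` of `M`. -/
def subquotient {M : DGModule.{uk, u, w} D} (U V : Sub M) : DGModule.{uk, u, w} D :=
  (U.restrict V).quotient

end Sub

/-- The kernel of a morphism of dg modules. -/
def Hom.ker {M : DGModule.{uk, u, w₁} D} {N : DGModule.{uk, u, w₂} D} (f : Hom M N) :
    Sub M where
  carrier i := (f.toFun i).ker
  act_mem := by
    intro i j n h x a hx
    rw [AddMonoidHom.mem_ker] at hx ⊢
    rw [f.map_act, hx]
    simp
  d_mem := by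
    intro i j h x hx
    rw [AddMonoidHom.mem_ker] at hx ⊢
    rw [f.map_d, hx, map_zero]

/-- The image of a morphism of dg modules. -/
def Hom.im {M : DGModule.{uk, u, w₁} D} {N : DGModule.{uk, u, w₂} D} (f : Hom M N) :
    Sub N where
  carrier i := (f.toFun i).range
  act_mem := by
    rintro i j n h _ a ⟨x, rfl⟩
    exact ⟨M.act h x a, f.map_act h x a⟩
  d_mem := by
    rintro i j h _ ⟨x, rfl⟩
    exact ⟨M.d h x, f.map_d h x⟩

section Hat

variable (D) (L : Type u) [AddCommGroup L] [Module (𝒜 0)ᵐᵒᵖ L]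

/-- The relations `(l r) ⊗ a = l ⊗ (r a)`, for `r ∈ A^0`, in `L ⊗_ℤ A^j`. -/
def hatRel (j : ℤ) : AddSubgroup (L ⊗[ℤ] 𝒜 j) :=
  AddSubgroup.closure {t | ∃ (l : L) (r : 𝒜 0) (a : 𝒜 j),
    t = (MulOpposite.op r • l) ⊗ₜ[ℤ] a - l ⊗ₜ[ℤ] D.gmul (zero_add j) r a}

/-- The group `L ⊗_{A^0} A^j`. -/
abbrev hatX (j : ℤ) : Type u := (L ⊗[ℤ] 𝒜 j) ⧸ hatRel D L j

/-- The class of the elementary tensor `l ⊗ a` in `L ⊗_{A^0} A^j`. -/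
def hatMk {j : ℤ} (l : L) (a : 𝒜 j) : hatX D L j := QuotientAddGroup.mk (l ⊗ₜ[ℤ] a)

variable {D L}

/-- An additive map `A^j → A^n` commuting with left multiplication by `A^0` induces a map
`L ⊗_{A^0} A^j → L ⊗_{A^0} A^n`. -/
def hatMap {j n : ℤ} (φ : 𝒜 j →+ 𝒜 n)
    (hφ : ∀ (r : 𝒜 0) (a : 𝒜 j),
      φ (D.gmul (zero_add j) r a) = D.gmul (zero_add n) r (φ a)) :
    hatX D L j →+ hatX D L n :=
  QuotientAddGroup.map _ _ (TensorProduct.map LinearMap.id φ.toIntLinearMap).toAddMonoidHom (by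
    rw [hatRel, AddSubgroup.closure_le]
    rintro _ ⟨l, r, a, rfl⟩
    refine AddSubgroup.subset_closure ⟨l, r, φ a, ?_⟩
    simp [hφ])

theorem hatMap_hatMk {j n : ℤ} (φ : 𝒜 j →+ 𝒜 n)
    (hφ : ∀ (r : 𝒜 0) (a : 𝒜 j),
      φ (D.gmul (zero_add j) r a) = D.gmul (zero_add n) r (φ a)) (l : L) (a : 𝒜 j) :
    hatMap φ hφ (hatMk D L l a) = hatMk D L l (φ a) := rfl

theorem hatMk_add {j : ℤ} (l : L) (a b : 𝒜 j) :
    hatMk D L l (a + b) = hatMk D L l a + hatMk D L l b := by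
  simp [hatMk, TensorProduct.tmul_add]

theorem hatMk_zsmul {j : ℤ} (l : L) (m : ℤ) (a : 𝒜 j) :
    hatMk D L l (m • a) = m • hatMk D L l a := by
  simp [hatMk, TensorProduct.tmul_smul]

theorem hat_induction {j : ℤ} {p : hatX D L j → Prop} (x : hatX D L j) (h0 : p 0)
    (hmk : ∀ l a, p (hatMk D L l a)) (hadd : ∀ x y, p x → p y → p (x + y)) : p x := by
  induction x using QuotientAddGroup.induction_on with
  | H x =>
    induction x using TensorProduct.induction_on with
    | zero => exact h0
    | tmul l a => exact hmk l a
    | add x y hx hy => exact hadd _ _ hx hy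

variable (D L)

/-- The action `(L ⊗_{A^0} A^i) × A^j → L ⊗_{A^0} A^n`, `(l ⊗ a) b = l ⊗ (a b)`. -/
def hatAct {i j n : ℤ} (h : i + j = n) : hatX D L i →+ 𝒜 j →+ hatX D L n :=
  AddMonoidHom.flip (AddMonoidHom.mk' (fun b : 𝒜 j =>
    hatMap (D := D) (L := L) (AddMonoidHom.mk' (fun a : 𝒜 i => D.gmul h a b)
      (fun a a' => Subtype.ext (add_mul _ _ _)))
      (fun r a => Subtype.ext (mul_assoc _ _ _)))
    (fun b b' => AddMonoidHom.ext fun x => by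
      induction x using hat_induction with
      | h0 => simp
      | hmk l a =>
        rw [AddMonoidHom.add_apply, hatMap_hatMk, hatMap_hatMk, hatMap_hatMk, ← hatMk_add]
        exact congrArg _ (Subtype.ext (mul_add _ _ _))
      | hadd x y hx hy => rw [map_add, hx, hy, map_add]))

theorem hatAct_hatMk {i j n : ℤ} (h : i + j = n) (l : L) (a : 𝒜 i) (b : 𝒜 j) :
    hatAct D L h (hatMk D L l a) b = hatMk D L l (D.gmul h a b) := rfl

/-- The differential `l ⊗ a ↦ l ⊗ d a`; it is well defined because `d` vanishes on `A^0`. -/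
def hatD (hD : ∀ a ∈ 𝒜 0, D.d a = 0) {i j : ℤ} (h : i + 1 = j) :
    hatX D L i →+ hatX D L j :=
  hatMap (AddMonoidHom.mk' (fun a : 𝒜 i => D.gd h a)
      (fun a a' => Subtype.ext (map_add D.d _ _)))
    (fun r a => Subtype.ext (by
      change D.d (r.1 * a.1) = r.1 * D.d a.1
      rw [D.leibniz r.2, hD _ r.2]
      simp))

theorem hatD_hatMk (hD : ∀ a ∈ 𝒜 0, D.d a = 0) {i j : ℤ} (h : i + 1 = j) (l : L) (a : 𝒜 i) :
    hatD D L hD h (hatMk D L l a) = hatMk D L l (D.gd h a) := rfl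

/-- The dg module `L ⊗_{A^0} A` for a right `A^0`-module `L`, viewed as a dg `A^0`-module
concentrated in degree zero. -/
def hat (hD : ∀ a ∈ 𝒜 0, D.d a = 0) : DGModule.{uk, u, u} D where
  X := hatX D L
  act := hatAct D L
  act_one x := by
    induction x using hat_induction with
    | h0 => simp
    | hmk l a =>
      rw [hatAct_hatMk]
      exact congrArg _ (Subtype.ext (mul_one _))
    | hadd x y hx hy => rw [map_add, AddMonoidHom.add_apply, hx, hy]
  act_act h₁ h₂ h₃ h₄ x a b := by
    induction x using hat_induction with
    | h0 => simp
    | hmk l c =>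
      rw [hatAct_hatMk, hatAct_hatMk, hatAct_hatMk]
      exact congrArg _ (Subtype.ext (mul_assoc _ _ _))
    | hadd x y hx hy => simp only [map_add, AddMonoidHom.add_apply, hx, hy]
  d := hatD D L hD
  d_d h₁ h₂ x := by
    induction x using hat_induction with
    | h0 => simp
    | hmk l c =>
      rw [hatD_hatMk, hatD_hatMk]
      have : D.gd h₂ (D.gd h₁ c) = 0 := Subtype.ext (D.d_d _)
      rw [this]
      simp [hatMk]
    | hadd x y hx hy => rw [map_add, map_add, hx, hy, add_zero]
  leibniz {i j n i' j' n'} h hi hj hn h₁ h₂ x a := by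
    induction x using hat_induction with
    | h0 => simp
    | hmk l c =>
      rw [hatAct_hatMk, hatD_hatMk, hatD_hatMk, hatAct_hatMk, hatAct_hatMk, Units.smul_def,
        ← hatMk_zsmul, ← hatMk_add]
      refine congrArg _ (Subtype.ext ?_)
      have := D.leibniz c.2 a.1
      rw [Units.smul_def] at this
      simpa [DGAlgebra.gd, DGAlgebra.gmul] using this
    | hadd x y hx hy =>
      simp only [map_add, AddMonoidHom.add_apply, hx, hy, smul_add]
      abel

end Hat

/-- `M` is an object of `dgFilt`: it has a finite filtration
`0 = F_0 ⊆ F_1 ⊆ ... ⊆ F_n = M` by dg submodules with `F_i / F_{i-1} ≅ {l_i} (L_i ⊗_{A^0} A)`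
for simple right `A^0`-modules `L_i` and integers `l_1 ≥ l_2 ≥ ... ≥ l_n`. -/
def IsFilt (hD : D.IsAdmissible) (M : DGModule.{uk, u, w} D) : Prop :=
  ∃ (n : ℕ) (F : Fin (n + 1) → Sub M) (l : Fin n → ℤ),
    F 0 = ⊥ ∧ F (Fin.last n) = ⊤ ∧ Monotone F ∧ Antitone l ∧
    ∀ i : Fin n, ∃ (L : Type u) (_ : AddCommGroup L) (_ : Module (𝒜 0)ᵐᵒᵖ L),
      IsSimpleModule (𝒜 0)ᵐᵒᵖ L ∧
      Nonempty (Iso (Sub.subquotient (F i.castSucc) (F i.succ)) (shift (l i) (hat D L hD.d_zero)))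

end DGModule

/-!
Forget the differentials: the modules `{l} (L ⊗_{A^0} A)` are graded projective, because `L` is
projective over `A^0`, so every filtration of the stated kind splits in the category of graded
modules and `M` is graded projective. Hence the ring `E` of graded `A`-linear endomorphisms of `M`
maps onto the ring of graded `A^0`-linear endomorphisms of the head `M / M A^{>0}`, and the kernel
is nilpotent: its elements map `M` into `M A^{>0}`, so products of many of them vanish in low
degrees, and an endomorphism that vanishes in the finitely many degrees where the head is nonzero
is zero. Since the head has finite length, Fitting's lemma makes its endomorphisms strongly
`π`-regular, and strong `π`-regularity lifts along surjections with nilpotent kernel. Thus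
`f ^ n ∈ f ^ (2 n) E ∩ E f ^ (2 n)` for large `n`, and this gives the decomposition.
-/

/-- An element `x` of a monoid is strongly `π`-regular if both chains `x R ⊇ x² R ⊇ ⋯` and
`R x ⊇ R x² ⊇ ⋯` become stationary. For an endomorphism of a module this is the algebraic form
of the Fitting decomposition. -/
def IsStronglyPiRegular {R : Type*} [Monoid R] (x : R) : Prop :=
  ∃ n : ℕ, (∃ y, x ^ n = x ^ (n + 1) * y) ∧ ∃ z, x ^ n = z * x ^ (n + 1)

theorem exists_pow_sub_pow_mul_mem_pow {R : Type*} [Ring R] {I : Ideal R} {x : R}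
    {N p : ℕ} (hx : ∃ y, x ^ N - x ^ p * y ∈ I) (k : ℕ) :
    ∃ y, x ^ (N * k) - x ^ p * y ∈ I ^ k := by
  obtain ⟨y', hy'⟩ := hx
  induction k with
  | zero => exact ⟨0, by simp [Submodule.pow_zero]⟩
  | succ k ih =>
    obtain ⟨y, hy⟩ := ih
    refine ⟨x ^ (N * k) * y' + y * (x ^ N - x ^ p * y'), ?_⟩
    rw [Submodule.pow_succ]
    convert Ideal.mul_mem_mul hy hy' using 1
    rw [mul_add (x ^ p), ← mul_assoc, (Commute.pow_pow_self x p (N * k)).eq, mul_add_one, pow_add]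
    noncomm_ring

theorem exists_pow_sub_mul_pow_mem_pow {R : Type*} [Ring R] {I : Ideal R} [I.IsTwoSided] {x : R}
    {N p : ℕ} (hx : ∃ z, x ^ N - z * x ^ p ∈ I) (k : ℕ) :
    ∃ z, x ^ (N * k) - z * x ^ p ∈ I ^ k := by
  obtain ⟨z', hz'⟩ := hx
  induction k with
  | zero => exact ⟨0, by simp [Submodule.pow_zero]⟩
  | succ k ih =>
    obtain ⟨z, hz⟩ := ih
    refine ⟨z' * x ^ (N * k) + (x ^ N - z' * x ^ p) * z, ?_⟩
    rw [Ideal.IsTwoSided.pow_succ]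
    convert Ideal.mul_mem_mul hz' hz using 1
    rw [add_mul, mul_assoc, (Commute.pow_pow_self x (N * k) p).eq, mul_add_one, add_comm, pow_add]
    noncomm_ring

namespace IsStronglyPiRegular

theorem exists_forall_pow_eq {R : Type*} [Monoid R] {x : R} (hx : IsStronglyPiRegular x) :
    ∃ N : ℕ, ∀ n ≥ N, ∀ p, (∃ y, x ^ n = x ^ (n + p) * y) ∧ ∃ z, x ^ n = z * x ^ (n + p) := by
  obtain ⟨N, ⟨y, hy⟩, z, hz⟩ := hx
  have step_right (m : ℕ) (hm : N ≤ m) : x ^ m = x ^ (m + 1) * y := by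
    obtain ⟨c, rfl⟩ := Nat.exists_eq_add_of_le' hm
    rw [pow_add, hy, ← mul_assoc, ← pow_add, add_assoc]
  have step_left (m : ℕ) (hm : N ≤ m) : x ^ m = z * x ^ (m + 1) := by
    obtain ⟨c, rfl⟩ := Nat.exists_eq_add_of_le hm
    rw [pow_add, hz, mul_assoc, ← pow_add, add_right_comm]
  refine ⟨N, fun n hn p => ?_⟩
  induction p with
  | zero => exact ⟨⟨1, (mul_one _).symm⟩, 1, (one_mul _).symm⟩
  | succ p ih =>
    obtain ⟨⟨y', hy'⟩, z', hz'⟩ := ih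
    refine ⟨⟨y * y', ?_⟩, z' * z, ?_⟩
    · rw [← mul_assoc, ← add_assoc, ← step_right _ (by omega), hy']
    · rw [mul_assoc, ← add_assoc, ← step_left _ (by omega), hz']

theorem pi {ι : Type*} {R : ι → Type*} [∀ i, Monoid (R i)] {x : ∀ i, R i} (s : Finset ι)
    (hs : ∀ i ∉ s, Subsingleton (R i)) (hx : ∀ i, IsStronglyPiRegular (x i)) :
    IsStronglyPiRegular x := by
  choose N hN using fun i => (hx i).exists_forall_pow_eq
  have stationary (i : ι) : (∃ y, x i ^ s.sup N = x i ^ (s.sup N + 1) * y) ∧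
      ∃ z, x i ^ s.sup N = z * x i ^ (s.sup N + 1) := by
    by_cases hi : i ∈ s
    · exact hN i _ (Finset.le_sup hi) 1
    · have := hs i hi
      exact ⟨⟨1, Subsingleton.elim _ _⟩, 1, Subsingleton.elim _ _⟩
  choose y hy using fun i => (stationary i).1
  choose z hz using fun i => (stationary i).2
  exact ⟨s.sup N, ⟨y, funext hy⟩, z, funext hz⟩

theorem of_ringHom {R S : Type*} [Ring R] [Ring S] (ρ : R →+* S) (hρ : Function.Surjective ρ)
    (hker : IsNilpotent (RingHom.ker ρ)) {x : R} (hx : IsStronglyPiRegular (ρ x)) :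
    IsStronglyPiRegular x := by
  obtain ⟨N, hN⟩ := hx.exists_forall_pow_eq
  obtain ⟨K, hK⟩ := hker
  have right (p : ℕ) : ∃ y, x ^ N - x ^ p * y ∈ RingHom.ker ρ := by
    obtain ⟨y, hy⟩ := (hN N le_rfl p).1
    obtain ⟨y, rfl⟩ := hρ y
    refine ⟨x ^ N * y, RingHom.mem_ker.2 ?_⟩
    rw [map_sub, sub_eq_zero, ← mul_assoc, ← pow_add, add_comm p, map_mul, map_pow, map_pow, hy]
  have left (p : ℕ) : ∃ z, x ^ N - z * x ^ p ∈ RingHom.ker ρ := by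
    obtain ⟨z, hz⟩ := (hN N le_rfl p).2
    obtain ⟨z, rfl⟩ := hρ z
    refine ⟨z * x ^ N, RingHom.mem_ker.2 ?_⟩
    rw [map_sub, sub_eq_zero, mul_assoc, ← pow_add, map_mul, map_pow, map_pow, hz]
  obtain ⟨y, hy⟩ := exists_pow_sub_pow_mul_mem_pow (right (N * K + 1)) K
  obtain ⟨z, hz⟩ := exists_pow_sub_mul_pow_mem_pow (left (N * K + 1)) K
  rw [hK, Ideal.zero_eq_bot, Ideal.mem_bot, sub_eq_zero] at hy hz
  exact ⟨N * K, ⟨y, hy⟩, z, hz⟩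

theorem moduleEnd {R V : Type*} [Ring R] [AddCommGroup V] [Module R V] (hV : IsFiniteLength R V)
    (f : Module.End R V) : IsStronglyPiRegular f := by
  obtain ⟨_, _⟩ := isFiniteLength_iff_isNoetherian_isArtinian.1 hV
  obtain ⟨n, hcompl, hn⟩ :=
    (f.eventually_isCompl_ker_pow_range_pow.and (Filter.eventually_ge_atTop 1)).exists
  let q := (LinearMap.ker (f ^ n)).projection (LinearMap.range (f ^ n)) hcompl
  have pow_mul_q : f ^ n * q = 0 :=
    LinearMap.ext fun v => LinearMap.mem_ker.1 (Submodule.projection_apply_mem hcompl v)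
  have q_mul_pow : q * f ^ n = 0 := LinearMap.ext fun v =>
    Submodule.projection_apply_of_mem_right hcompl (LinearMap.mem_range_self (f ^ n) v)
  have injective : Function.Injective (f ^ n + q) := by
    refine (injective_iff_map_eq_zero _).2 fun v (hv : (f ^ n) v + q v = 0) => ?_
    have hqv : q v = 0 := (Submodule.disjoint_def.1 hcompl.disjoint) _
      (Submodule.projection_apply_mem hcompl v)
      (by rw [← neg_eq_of_add_eq_zero_right hv]; exact neg_mem (LinearMap.mem_range_self _ v))
    rw [hqv, add_zero] at hv
    exact (Submodule.projection_apply_of_mem_left hcompl (LinearMap.mem_ker.2 hv)).symm.trans hqv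
  obtain ⟨u, hu⟩ := (Module.End.isUnit_iff _).2
    (IsArtinian.bijective_of_injective_endomorphism _ injective)
  have pow_mul_u : f ^ n * u = f ^ (n + n) := by rw [hu, mul_add, pow_mul_q, add_zero, pow_add]
  have u_mul_pow : u * f ^ n = f ^ (n + n) := by rw [hu, add_mul, q_mul_pow, add_zero, pow_add]
  refine ⟨n, ⟨f ^ (n - 1) * u⁻¹, ?_⟩, u⁻¹ * f ^ (n - 1), ?_⟩
  · rw [← mul_assoc, ← pow_add, show n + 1 + (n - 1) = n + n by omega, ← pow_mul_u,
      Units.mul_inv_cancel_right]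
  · rw [mul_assoc, ← pow_add, show n - 1 + (n + 1) = n + n by omega, ← u_mul_pow,
      Units.inv_mul_cancel_left]

end IsStronglyPiRegular

namespace DGModule

variable {k : Type uk} [CommRing k] {A : Type u} [Ring A] [Algebra k A]
  {𝒜 : ℤ → Submodule k A} [GradedAlgebra 𝒜] {D : DGAlgebra 𝒜}

section GradedLinear

/-- A family of additive maps `M^i → N^i` is graded linear if it commutes with the action of `A`,
but not necessarily with the differentials. -/
structure IsGradedLinear {M : DGModule.{uk, u, w₁} D} {N : DGModule.{uk, u, w₂} D}
    (φ : ∀ i, M.X i →+ N.X i) : Prop where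
  map_act : ∀ {i j n : ℤ} (h : i + j = n) (x : M.X i) (a : 𝒜 j),
    φ n (M.act h x a) = N.act h (φ i x) a

/-- The component `M^i` as a right module over `A^0`. -/
instance componentModule (M : DGModule.{uk, u, w} D) (i : ℤ) : Module (𝒜 0)ᵐᵒᵖ (M.X i) where
  smul r x := M.act (add_zero i) x r.unop
  one_smul x := M.act_one x
  mul_smul r s x :=
    (M.act_act (add_zero i) (add_zero i) (add_zero 0) (add_zero i) x s.unop r.unop).symm
  smul_zero r := DFunLike.congr_fun (map_zero (M.act (add_zero i))) r.unop
  smul_add r x y := DFunLike.congr_fun (map_add (M.act (add_zero i)) x y) r.unop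
  add_smul r s x := map_add (M.act (add_zero i) x) r.unop s.unop
  zero_smul x := map_zero (M.act (add_zero i) x)

variable {M : DGModule.{uk, u, w₁} D} {N : DGModule.{uk, u, w₂} D} {P : DGModule.{uk, u, w₃} D}

theorem Hom.isGradedLinear (f : Hom M N) : IsGradedLinear f.toFun := ⟨f.map_act⟩

namespace IsGradedLinear

theorem id : IsGradedLinear fun i => AddMonoidHom.id (M.X i) := ⟨fun _ _ _ => rfl⟩

theorem comp {ψ : ∀ i, N.X i →+ P.X i} {φ : ∀ i, M.X i →+ N.X i} (hψ : IsGradedLinear ψ)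
    (hφ : IsGradedLinear φ) : IsGradedLinear fun i => (ψ i).comp (φ i) :=
  ⟨fun h x a => by simp only [AddMonoidHom.comp_apply, hφ.map_act h, hψ.map_act h]⟩

theorem zero : IsGradedLinear fun i => (0 : M.X i →+ N.X i) :=
  ⟨fun h x a => by simp⟩

theorem add {φ ψ : ∀ i, M.X i →+ N.X i} (hφ : IsGradedLinear φ) (hψ : IsGradedLinear ψ) :
    IsGradedLinear fun i => φ i + ψ i :=
  ⟨fun h x a => by simp only [AddMonoidHom.add_apply, hφ.map_act h, hψ.map_act h, map_add]⟩

theorem neg {φ : ∀ i, M.X i →+ N.X i} (hφ : IsGradedLinear φ) :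
    IsGradedLinear fun i => -φ i :=
  ⟨fun h x a => by simp only [AddMonoidHom.neg_apply, hφ.map_act h, map_neg]⟩

theorem sub {φ ψ : ∀ i, M.X i →+ N.X i} (hφ : IsGradedLinear φ) (hψ : IsGradedLinear ψ) :
    IsGradedLinear fun i => φ i - ψ i :=
  ⟨fun h x a => by simp only [AddMonoidHom.sub_apply, hφ.map_act h, hψ.map_act h, map_sub]⟩

/-- The `A^0`-linear map `M^i → N^i` underlying a graded linear family. -/
def component {φ : ∀ i, M.X i →+ N.X i} (hφ : IsGradedLinear φ) (i : ℤ) :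
    M.X i →ₗ[(𝒜 0)ᵐᵒᵖ] N.X i where
  toFun := φ i
  map_add' := map_add _
  map_smul' r x := hφ.map_act (add_zero i) x r.unop

end IsGradedLinear

/-- The ring of graded linear endomorphisms of `M`. -/
def gradedEnd (M : DGModule.{uk, u, w} D) : Subring (∀ i, AddMonoid.End (M.X i)) where
  carrier := {φ | IsGradedLinear φ}
  mul_mem' hφ hψ := IsGradedLinear.comp hφ hψ
  one_mem' := IsGradedLinear.id
  add_mem' hφ hψ := IsGradedLinear.add hφ hψ
  zero_mem' := IsGradedLinear.zero
  neg_mem' hφ := IsGradedLinear.neg hφ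

/-- The graded linear endomorphism underlying an endomorphism of dg modules. -/
def Hom.toGradedEnd (M : DGModule.{uk, u, w} D) : Hom M M →* gradedEnd M where
  toFun f := ⟨f.toFun, f.isGradedLinear⟩
  map_one' := rfl
  map_mul' _ _ := rfl

end GradedLinear

section Sub

variable {M : DGModule.{uk, u, w} D}

/-- The inclusion of a dg submodule. -/
def Sub.subtype (U : Sub M) : Hom U.toDGModule M where
  toFun i := (U.carrier i).subtype
  map_act _ _ _ := rfl
  map_d _ _ := rfl

/-- The projection onto the quotient by a dg submodule. -/
def Sub.mkQ (U : Sub M) : Hom M U.quotient where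
  toFun i := QuotientAddGroup.mk' (U.carrier i)
  map_act _ _ _ := rfl
  map_d _ _ := rfl

theorem Sub.mkQ_surjective (U : Sub M) (i : ℤ) : Function.Surjective (U.mkQ.toFun i) :=
  QuotientAddGroup.mk'_surjective (U.carrier i)

theorem Sub.mkQ_eq_zero_iff (U : Sub M) {i : ℤ} {x : M.X i} :
    U.mkQ.toFun i x = 0 ↔ x ∈ U.carrier i := QuotientAddGroup.eq_zero_iff x

end Sub

section Head

/-- The component of degree `n` of `M A^{>0} A`. -/
def radCarrier (M : DGModule.{uk, u, w} D) (n : ℤ) : AddSubgroup (M.X n) :=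
  AddSubgroup.closure {y | ∃ (i j m l : ℤ) (h : i + j = m) (h' : m + l = n) (x : M.X i) (a : 𝒜 j)
    (b : 𝒜 l), 0 < j ∧ M.act h' (M.act h x a) b = y}

theorem act_act_mem_radCarrier (M : DGModule.{uk, u, w} D) {i j m l n : ℤ} (h : i + j = m)
    (h' : m + l = n) (hj : 0 < j) (x : M.X i) (a : 𝒜 j) (b : 𝒜 l) :
    M.act h' (M.act h x a) b ∈ M.radCarrier n :=
  AddSubgroup.subset_closure ⟨i, j, m, l, h, h', x, a, b, hj, rfl⟩

theorem radCarrier_le {M : DGModule.{uk, u, w} D} {n : ℤ} {S : AddSubgroup (M.X n)}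
    (hS : ∀ {i j m l : ℤ} (h : i + j = m) (h' : m + l = n) (x : M.X i) (a : 𝒜 j) (b : 𝒜 l),
      0 < j → M.act h' (M.act h x a) b ∈ S) : M.radCarrier n ≤ S := by
  refine (AddSubgroup.closure_le _).2 ?_
  rintro _ ⟨i, j, m, l, h, h', x, a, b, hj, rfl⟩
  exact hS h h' x a b hj

theorem radCarrier_le_comap_act (M : DGModule.{uk, u, w} D) {n e n' : ℤ} (h : n + e = n')
    (c : 𝒜 e) : M.radCarrier n ≤ (M.radCarrier n').comap ((M.act h).flip c) :=
  radCarrier_le fun {i j m l} h₁ h₂ x a b hj => by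
    rw [AddSubgroup.mem_comap, AddMonoidHom.flip_apply,
      M.act_act h₂ h rfl (by omega : m + (l + e) = n')]
    exact M.act_act_mem_radCarrier h₁ _ hj x a _

theorem radCarrier_le_comap_d (M : DGModule.{uk, u, w} D) {n n' : ℤ} (h : n + 1 = n') :
    M.radCarrier n ≤ (M.radCarrier n').comap (M.d h) :=
  radCarrier_le fun {i j m l} h₁ h₂ x a b hj => by
    rw [AddSubgroup.mem_comap, M.leibniz h₂ rfl rfl h (by omega) (by omega),
      M.leibniz h₁ rfl rfl rfl (by omega) (by omega), map_add, AddMonoidHom.add_apply,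
      Units.smul_def, Units.smul_def, map_zsmul, AddMonoidHom.coe_smul, Pi.smul_apply]
    refine add_mem (add_mem ?_ (zsmul_mem ?_ _)) (zsmul_mem ?_ _) <;>
      exact M.act_act_mem_radCarrier _ _ (by omega) _ _ _

/-- The dg submodule `M A^{>0} A` of `M`. If `A` is concentrated in degrees `≥ 0`, then this
is `M A^{>0}`; the second factor makes it a dg submodule without this assumption. -/
def rad (M : DGModule.{uk, u, w} D) : Sub M where
  carrier := M.radCarrier
  act_mem h _ c hx := M.radCarrier_le_comap_act h c hx
  d_mem h _ hx := M.radCarrier_le_comap_d h hx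

theorem act_mem_rad (M : DGModule.{uk, u, w} D) {i j n : ℤ} (h : i + j = n) (hj : 0 < j)
    (x : M.X i) (a : 𝒜 j) : M.act h x a ∈ M.rad.carrier n := by
  rw [← M.act_one (M.act h x a)]
  exact M.act_act_mem_radCarrier h _ hj x a _

theorem rad_le (hpos : ∀ i : ℤ, i < 0 → 𝒜 i = ⊥) {M : DGModule.{uk, u, w} D} {n : ℤ}
    {S : AddSubgroup (M.X n)}
    (hS : ∀ {i j : ℤ} (h : i + j = n) (x : M.X i) (a : 𝒜 j), 0 < j → M.act h x a ∈ S) :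
    M.rad.carrier n ≤ S :=
  radCarrier_le fun {i j m l} h h' x a b hj => by
    rcases lt_or_ge l 0 with hl | hl
    · have : Subsingleton (𝒜 l) := Submodule.subsingleton_iff_eq_bot.2 (hpos l hl)
      rw [Subsingleton.elim b 0, map_zero]
      exact zero_mem S
    · rw [M.act_act h h' rfl (by omega : i + (j + l) = n)]
      exact hS _ x _ (by omega)

variable {M : DGModule.{uk, u, w₁} D} {N : DGModule.{uk, u, w₂} D}

theorem IsGradedLinear.map_rad_le {φ : ∀ i, M.X i →+ N.X i} (hφ : IsGradedLinear φ) (n : ℤ) :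
    M.rad.carrier n ≤ (N.rad.carrier n).comap (φ n) :=
  radCarrier_le fun h h' x a b hj => by
    rw [AddSubgroup.mem_comap, hφ.map_act, hφ.map_act]
    exact N.act_act_mem_radCarrier h h' hj _ a b

/-- The head `M / M A^{>0} A` of `M`. -/
abbrev head (M : DGModule.{uk, u, w} D) : DGModule.{uk, u, w} D := M.rad.quotient

theorem head_act_eq_zero {i j n : ℤ} (h : i + j = n) (hj : 0 < j) (x : M.head.X i) (a : 𝒜 j) :
    M.head.act h x a = 0 := by
  obtain ⟨x, rfl⟩ := M.rad.mkQ_surjective i x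
  rw [← M.rad.mkQ.map_act, Sub.mkQ_eq_zero_iff]
  exact M.act_mem_rad h hj x a

theorem isGradedLinear_of_head (hpos : ∀ i : ℤ, i < 0 → 𝒜 i = ⊥)
    (φ : ∀ i, M.head.X i →ₗ[(𝒜 0)ᵐᵒᵖ] N.head.X i) :
    IsGradedLinear fun i => (φ i).toAddMonoidHom := by
  refine ⟨fun {i j n} h x a => ?_⟩
  rcases lt_trichotomy j 0 with hj | rfl | hj
  · have : Subsingleton (𝒜 j) := Submodule.subsingleton_iff_eq_bot.2 (hpos j hj)
    rw [Subsingleton.elim a 0, map_zero, map_zero, map_zero]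
  · obtain rfl : i = n := by omega
    exact (φ i).map_smul (MulOpposite.op a) x
  · rw [head_act_eq_zero h hj, head_act_eq_zero h hj, map_zero]

namespace IsGradedLinear

/-- The map induced on heads by a graded linear family. -/
def headMap {φ : ∀ i, M.X i →+ N.X i} (hφ : IsGradedLinear φ) (i : ℤ) :
    M.head.X i →ₗ[(𝒜 0)ᵐᵒᵖ] N.head.X i :=
  component (φ := fun i => QuotientAddGroup.map _ _ (φ i) (hφ.map_rad_le i)) ⟨fun h x a => by
    obtain ⟨x, rfl⟩ := M.rad.mkQ_surjective _ x
    exact congrArg (N.rad.mkQ.toFun _) (hφ.map_act h x a)⟩ i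

theorem headMap_mkQ {φ : ∀ i, M.X i →+ N.X i} (hφ : IsGradedLinear φ) {i : ℤ} (x : M.X i) :
    hφ.headMap i (M.rad.mkQ.toFun i x) = N.rad.mkQ.toFun i (φ i x) := rfl

end IsGradedLinear

/-- The action of graded linear endomorphisms on the head. -/
def headHom (M : DGModule.{uk, u, w} D) :
    gradedEnd M →+* ∀ i, Module.End (𝒜 0)ᵐᵒᵖ (M.head.X i) where
  toFun φ i := IsGradedLinear.headMap φ.2 i
  map_one' := by
    ext i x
    obtain ⟨x, rfl⟩ := M.rad.mkQ_surjective i x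
    rfl
  map_mul' φ ψ := by
    ext i x
    obtain ⟨x, rfl⟩ := M.rad.mkQ_surjective i x
    rfl
  map_zero' := by
    ext i x
    obtain ⟨x, rfl⟩ := M.rad.mkQ_surjective i x
    rfl
  map_add' φ ψ := by
    ext i x
    obtain ⟨x, rfl⟩ := M.rad.mkQ_surjective i x
    rfl

theorem apply_mem_rad_of_mem_ker_headHom {φ : gradedEnd N} (hφ : φ ∈ RingHom.ker N.headHom)
    {i : ℤ} (x : N.X i) : φ.1 i x ∈ N.rad.carrier i := by
  have : N.headHom φ i (N.rad.mkQ.toFun i x) = 0 := by rw [RingHom.mem_ker.1 hφ]; rfl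
  exact N.rad.mkQ_eq_zero_iff.1 this

/-- The graded linear endomorphisms that vanish in degrees below `c`. -/
def vanishingIdeal (M : DGModule.{uk, u, w} D) (c : ℤ) : Ideal (gradedEnd M) where
  carrier := {φ | ∀ i < c, φ.1 i = 0}
  add_mem' hφ hψ i hi := by simp [hφ i hi, hψ i hi]
  zero_mem' _ _ := rfl
  smul_mem' ψ φ hφ i hi := by simp [hφ i hi]

end Head

section Projective

/-- `M` is graded projective if graded linear families out of `M` lift along surjective graded
linear families. -/
def IsGradedProjective (M : DGModule.{uk, u, w₁} D) : Prop :=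
  ∀ ⦃N N' : DGModule.{uk, u, w₂} D⦄ (q : ∀ i, N.X i →+ N'.X i) (φ : ∀ i, M.X i →+ N'.X i),
    IsGradedLinear q → (∀ i, Function.Surjective (q i)) → IsGradedLinear φ →
      ∃ ψ : ∀ i, M.X i →+ N.X i, IsGradedLinear ψ ∧ ∀ i x, q i (ψ i x) = φ i x

/-- `M` is graded projective and bounded below, and its head has finite length over `A^0`. -/
structure IsFiniteProjective (M : DGModule.{uk, u, w₁} D) : Prop where
  projective : IsGradedProjective.{uk, u, w₁, w₂} M
  bounded_below : ∃ a : ℤ, ∀ i < a, Subsingleton (M.X i)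
  head_bounded_above : ∃ b : ℤ, ∀ i ≥ b, Subsingleton (M.head.X i)
  head_finiteLength : ∀ i, IsFiniteLength (𝒜 0)ᵐᵒᵖ (M.head.X i)

variable {M : DGModule.{uk, u, w} D}

theorem IsGradedProjective.headHom_surjective (hpos : ∀ i : ℤ, i < 0 → 𝒜 i = ⊥)
    (hM : IsGradedProjective.{uk, u, w, w} M) : Function.Surjective M.headHom := by
  intro φ
  obtain ⟨ψ, hψ, hψφ⟩ := hM M.rad.mkQ.toFun
    (fun i => (φ i).toAddMonoidHom.comp (M.rad.mkQ.toFun i)) M.rad.mkQ.isGradedLinear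
    M.rad.mkQ_surjective ((isGradedLinear_of_head hpos φ).comp M.rad.mkQ.isGradedLinear)
  refine ⟨⟨ψ, hψ⟩, funext fun i => LinearMap.ext fun x => ?_⟩
  obtain ⟨x, rfl⟩ := M.rad.mkQ_surjective i x
  exact hψφ i x

theorem IsGradedLinear.apply_eq_zero_of_mem_rad (hpos : ∀ i : ℤ, i < 0 → 𝒜 i = ⊥)
    {N : DGModule.{uk, u, w₂} D} {φ : ∀ i, M.X i →+ N.X i} (hφ : IsGradedLinear φ) {c n : ℤ}
    (hc : ∀ i < c, φ i = 0) (hn : n ≤ c) {x : M.X n} (hx : x ∈ M.rad.carrier n) : φ n x = 0 :=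
  rad_le hpos (S := (φ n).ker) (fun {i j} h x a hj => by
    rw [AddMonoidHom.mem_ker, hφ.map_act, hc i (by omega), AddMonoidHom.zero_apply, map_zero,
      AddMonoidHom.zero_apply]) hx

theorem ker_headHom_pow_le (hpos : ∀ i : ℤ, i < 0 → 𝒜 i = ⊥) {a : ℤ}
    (ha : ∀ i < a, Subsingleton (M.X i)) (n : ℕ) :
    RingHom.ker M.headHom ^ n ≤ M.vanishingIdeal (a + n) := by
  induction n with
  | zero =>
    intro φ _ i hi
    have := ha i (by simpa using hi)
    exact AddMonoidHom.ext fun x => Subsingleton.elim _ _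
  | succ n ih =>
    rw [Submodule.pow_succ]
    refine Ideal.mul_le.2 fun φ hφ ψ hψ i hi => AddMonoidHom.ext fun x => ?_
    exact IsGradedLinear.apply_eq_zero_of_mem_rad hpos φ.2 (ih hφ) (by push_cast at hi; omega)
      (apply_mem_rad_of_mem_ker_headHom hψ x)

theorem vanishingIdeal_eq_bot (hpos : ∀ i : ℤ, i < 0 → 𝒜 i = ⊥) {b : ℤ}
    (hb : ∀ i ≥ b, Subsingleton (M.head.X i)) : M.vanishingIdeal b = ⊥ := by
  refine (Submodule.eq_bot_iff _).2 fun φ hφ => ?_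
  have vanishes_below (c : ℤ) (hc : b ≤ c) : ∀ i < c, φ.1 i = 0 := by
    induction c, hc using Int.leInduction with
    | base => exact hφ
    | succ c hc ih =>
      intro i hi
      rcases (Int.lt_add_one_iff.1 hi).lt_or_eq with hi | rfl
      · exact ih i hi
      · have := hb i hc
        exact AddMonoidHom.ext fun x => IsGradedLinear.apply_eq_zero_of_mem_rad hpos φ.2 ih le_rfl
          (M.rad.mkQ_eq_zero_iff.1 (Subsingleton.elim _ _))
  exact Subtype.ext (funext fun i =>
    vanishes_below (max b (i + 1)) (le_max_left _ _) i (by omega))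

namespace IsFiniteProjective

theorem isNilpotent_ker_headHom (hpos : ∀ i : ℤ, i < 0 → 𝒜 i = ⊥)
    (hM : IsFiniteProjective.{uk, u, w, w₂} M) : IsNilpotent (RingHom.ker M.headHom) := by
  obtain ⟨a, ha⟩ := hM.bounded_below
  obtain ⟨b, hb⟩ := hM.head_bounded_above
  refine ⟨(b - a).toNat, le_bot_iff.1 ?_⟩
  calc RingHom.ker M.headHom ^ (b - a).toNat
      ≤ M.vanishingIdeal (a + (b - a).toNat) := ker_headHom_pow_le hpos ha _
    _ ≤ M.vanishingIdeal b := fun φ hφ i hi => hφ i (by omega)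
    _ = ⊥ := vanishingIdeal_eq_bot hpos hb

theorem isStronglyPiRegular (hpos : ∀ i : ℤ, i < 0 → 𝒜 i = ⊥)
    (hM : IsFiniteProjective.{uk, u, w, w} M) (φ : gradedEnd M) : IsStronglyPiRegular φ := by
  obtain ⟨a, ha⟩ := hM.bounded_below
  obtain ⟨b, hb⟩ := hM.head_bounded_above
  refine .of_ringHom M.headHom (hM.projective.headHom_surjective hpos)
    (hM.isNilpotent_ker_headHom hpos) (.pi (Finset.Ico a b) (fun i hi => ?_)
      fun i => .moduleEnd (hM.head_finiteLength i) _)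
  have : Subsingleton (M.head.X i) := by
    rcases lt_or_ge i a with hia | hia
    · have := ha i hia
      exact (M.rad.mkQ_surjective i).subsingleton
    · exact hb i (by simpa [hia] using hi)
  infer_instance

theorem of_subsingleton {M : DGModule.{uk, u, w₁} D} (hM : ∀ i, Subsingleton (M.X i)) :
    IsFiniteProjective.{uk, u, w₁, w₂} M where
  projective _ _ q φ _ _ _ := ⟨fun _ => 0, .zero, fun i x => by
    rw [AddMonoidHom.zero_apply, map_zero, Subsingleton.elim x 0, map_zero]⟩
  bounded_below := ⟨0, fun i _ => hM i⟩
  head_bounded_above := ⟨0, fun i _ => (M.rad.mkQ_surjective i).subsingleton⟩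
  head_finiteLength i :=
    have : Subsingleton (M.head.X i) := (M.rad.mkQ_surjective i).subsingleton
    .of_subsingleton

theorem of_add_eq_id {M' : DGModule.{uk, u, w₁} D} {M : DGModule.{uk, u, w} D}
    {M'' : DGModule.{uk, u, w₃} D} (hM' : IsFiniteProjective.{uk, u, w₁, w₂} M')
    (hM'' : IsFiniteProjective.{uk, u, w₃, w₂} M'') {α : ∀ i, M'.X i →+ M.X i}
    {ρ : ∀ i, M.X i →+ M'.X i} {σ : ∀ i, M''.X i →+ M.X i} {β : ∀ i, M.X i →+ M''.X i}
    (hα : IsGradedLinear α) (hρ : IsGradedLinear ρ) (hσ : IsGradedLinear σ) (hβ : IsGradedLinear β)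
    (add_eq_id : ∀ i x, α i (ρ i x) + σ i (β i x) = x) :
    IsFiniteProjective.{uk, u, w, w₂} M := by
  have head_surjective (i : ℤ) :
      Function.Surjective ((hα.headMap i).coprod (hσ.headMap i)) := by
    intro x
    obtain ⟨x, rfl⟩ := M.rad.mkQ_surjective i x
    refine ⟨(M'.rad.mkQ.toFun i (ρ i x), M''.rad.mkQ.toFun i (β i x)), ?_⟩
    rw [LinearMap.coprod_apply, hα.headMap_mkQ, hσ.headMap_mkQ, ← map_add, add_eq_id]
  refine ⟨fun N N' q φ hq hq_surj hφ => ?_, ?_, ?_, fun i => ?_⟩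
  · obtain ⟨ψ', hψ', hqψ'⟩ := hM'.projective q _ hq hq_surj (hφ.comp hα)
    obtain ⟨ψ'', hψ'', hqψ''⟩ := hM''.projective q _ hq hq_surj (hφ.comp hσ)
    refine ⟨_, (hψ'.comp hρ).add (hψ''.comp hβ), fun i x => ?_⟩
    rw [AddMonoidHom.add_apply, AddMonoidHom.comp_apply, AddMonoidHom.comp_apply, map_add, hqψ',
      hqψ'', AddMonoidHom.comp_apply, AddMonoidHom.comp_apply, ← map_add, add_eq_id]
  · obtain ⟨a', ha'⟩ := hM'.bounded_below
    obtain ⟨a'', ha''⟩ := hM''.bounded_below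
    refine ⟨min a' a'', fun i hi => ⟨fun x y => ?_⟩⟩
    have := ha' i (by omega)
    have := ha'' i (by omega)
    rw [← add_eq_id i x, ← add_eq_id i y, Subsingleton.elim (ρ i x), Subsingleton.elim (β i x)]
  · obtain ⟨b', hb'⟩ := hM'.head_bounded_above
    obtain ⟨b'', hb''⟩ := hM''.head_bounded_above
    refine ⟨max b' b'', fun i hi => ?_⟩
    have := hb' i (by omega)
    have := hb'' i (by omega)
    exact (head_surjective i).subsingleton
  · obtain ⟨_, _⟩ := isFiniteLength_iff_isNoetherian_isArtinian.1 (hM'.head_finiteLength i)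
    obtain ⟨_, _⟩ := isFiniteLength_iff_isNoetherian_isArtinian.1 (hM''.head_finiteLength i)
    exact .of_surjective (isFiniteLength_iff_isNoetherian_isArtinian.2
      ⟨inferInstance, inferInstance⟩) (head_surjective i)

end IsFiniteProjective

end Projective

section ShiftedHat

variable {L : Type u} [AddCommGroup L] [Module (𝒜 0)ᵐᵒᵖ L] {M : DGModule.{uk, u, w} D}

theorem hatMk_add_left {j : ℤ} (x y : L) (a : 𝒜 j) :
    hatMk D L (x + y) a = hatMk D L x a + hatMk D L y a := by
  simp only [hatMk, TensorProduct.add_tmul, QuotientAddGroup.mk_add]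

theorem hatMk_op_smul {j : ℤ} (x : L) (r : 𝒜 0) (a : 𝒜 j) :
    hatMk D L (MulOpposite.op r • x) a = hatMk D L x (D.gmul (zero_add j) r a) :=
  QuotientAddGroup.eq_iff_sub_mem.2 (AddSubgroup.subset_closure ⟨x, r, a, rfl⟩)

/-- The map `L ⊗_{A^0} A^j → M^n`, `x ⊗ a ↦ φ(x) a`, for an `A^0`-linear map `φ : L → M^m`
and `m + j = n`. -/
def hatLift {m j n : ℤ} (φ : L →ₗ[(𝒜 0)ᵐᵒᵖ] M.X m) (h : m + j = n) : hatX D L j →+ M.X n :=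
  QuotientAddGroup.lift (hatRel D L j)
    (TensorProduct.liftAddHom ((M.act h).comp φ.toAddMonoidHom) fun c x a => by simp)
    ((AddSubgroup.closure_le _).2 (by
      rintro _ ⟨x, r, a, rfl⟩
      simp only [SetLike.mem_coe, AddMonoidHom.mem_ker, map_sub, TensorProduct.liftAddHom_tmul,
        sub_eq_zero]
      exact (congrArg (fun y => M.act h y a) (φ.map_smul (MulOpposite.op r) x)).trans
        (M.act_act (add_zero m) h (zero_add j) h (φ x) r a)))

theorem hatLift_hatMk {m j n : ℤ} (φ : L →ₗ[(𝒜 0)ᵐᵒᵖ] M.X m) (h : m + j = n) (x : L) (a : 𝒜 j) :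
    hatLift φ h (hatMk D L x a) = M.act h (φ x) a := rfl

variable (hd : ∀ a ∈ 𝒜 0, D.d a = 0) (l : ℤ)

variable (L) in
/-- The generators `x ⊗ 1` of `{l} (L ⊗_{A^0} A)`, in degree `-l`. -/
def hatUnit : L →ₗ[(𝒜 0)ᵐᵒᵖ] (shift l (hat D L hd)).X (-l) where
  toFun x := hatMk D L x (j := -l + l) ⟨1, (neg_add_cancel l).symm ▸ SetLike.one_mem_graded 𝒜⟩
  map_add' x y := hatMk_add_left x y _
  map_smul' r x := (hatMk_op_smul x r.unop _).trans
    (congrArg (hatMk D L x) (Subtype.ext ((mul_one _).trans (one_mul _).symm)))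

theorem act_hatUnit {n : ℤ} (x : L) (a : 𝒜 (n + l)) :
    (shift l (hat D L hd)).act (neg_add_cancel_comm_assoc l n) (hatUnit L hd l x) a =
      hatMk D L x a :=
  congrArg (hatMk D L x) (Subtype.ext (one_mul _))

theorem shift_hat_induction {i : ℤ} {p : (shift l (hat D L hd)).X i → Prop}
    (x : (shift l (hat D L hd)).X i) (zero : p 0)
    (act_unit : ∀ (x : L) (a : 𝒜 (i + l)),
      p ((shift l (hat D L hd)).act (neg_add_cancel_comm_assoc l i) (hatUnit L hd l x) a))
    (add : ∀ x y, p x → p y → p (x + y)) : p x :=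
  hat_induction x zero (fun x a => act_hatUnit hd l x a ▸ act_unit x a) add

/-- The graded linear family `{l} (L ⊗_{A^0} A) → M` extending `φ : L → M^{-l}`. -/
def shiftHatLift (φ : L →ₗ[(𝒜 0)ᵐᵒᵖ] M.X (-l)) (i : ℤ) : (shift l (hat D L hd)).X i →+ M.X i :=
  hatLift φ (neg_add_cancel_comm_assoc l i)

theorem shiftHatLift_act_hatUnit (φ : L →ₗ[(𝒜 0)ᵐᵒᵖ] M.X (-l)) {i : ℤ} (x : L) (a : 𝒜 (i + l)) :
    shiftHatLift hd l φ i
        ((shift l (hat D L hd)).act (neg_add_cancel_comm_assoc l i) (hatUnit L hd l x) a) =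
      M.act (neg_add_cancel_comm_assoc l i) (φ x) a :=
  (congrArg (shiftHatLift hd l φ i) (act_hatUnit hd l x a)).trans (hatLift_hatMk φ _ x a)

theorem isGradedLinear_shiftHatLift (φ : L →ₗ[(𝒜 0)ᵐᵒᵖ] M.X (-l)) :
    IsGradedLinear (shiftHatLift hd l φ) := by
  refine ⟨fun {i j n} h x a => ?_⟩
  induction x using shift_hat_induction with
  | zero => simp only [map_zero, AddMonoidHom.zero_apply]
  | act_unit x b =>
    rw [act_act _ _ _ (add_right_comm i l j ▸ congrArg (· + l) h) (neg_add_cancel_comm_assoc l n),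
      shiftHatLift_act_hatUnit, shiftHatLift_act_hatUnit, M.act_act]
  | add x y hx hy => simp only [map_add, AddMonoidHom.add_apply, hx, hy]

theorem subsingleton_shift_hat (hpos : ∀ i : ℤ, i < 0 → 𝒜 i = ⊥) {i : ℤ} (hi : i < -l) :
    Subsingleton ((shift l (hat D L hd)).X i) := by
  have : Subsingleton (𝒜 (i + l)) := Submodule.subsingleton_iff_eq_bot.2 (hpos _ (by omega))
  refine subsingleton_of_forall_eq 0 fun x => ?_
  induction x using shift_hat_induction with
  | zero => rfl
  | act_unit x a => rw [Subsingleton.elim a 0, map_zero]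
  | add x y hx hy => rw [hx, hy, add_zero]

theorem subsingleton_head_shift_hat {i : ℤ} (hi : -l < i) :
    Subsingleton ((shift l (hat D L hd)).head.X i) := by
  refine subsingleton_of_forall_eq 0 fun x => ?_
  obtain ⟨x, rfl⟩ := Sub.mkQ_surjective _ i x
  rw [Sub.mkQ_eq_zero_iff]
  induction x using shift_hat_induction with
  | zero => exact zero_mem _
  | act_unit x a => exact act_mem_rad _ _ (by omega) _ _
  | add x y hx hy => exact add_mem hx hy

theorem hatUnit_surjective : Function.Surjective (hatUnit (D := D) L hd l) := by
  intro x
  induction x using hat_induction with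
  | h0 => exact ⟨0, map_zero _⟩
  | hmk x a =>
    have ha : a.1 ∈ 𝒜 0 := neg_add_cancel l ▸ a.2
    refine ⟨MulOpposite.op ⟨a, ha⟩ • x, (hatMk_op_smul x _ _).trans ?_⟩
    exact congrArg (hatMk D L x) (Subtype.ext (mul_one _))
  | hadd x y hx hy =>
    obtain ⟨x, rfl⟩ := hx
    obtain ⟨y, rfl⟩ := hy
    exact ⟨x + y, map_add _ x y⟩

theorem isGradedProjective_shift_hat [Module.Projective (𝒜 0)ᵐᵒᵖ L] :
    IsGradedProjective.{uk, u, u, w₂} (shift l (hat D L hd)) := by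
  intro N N' q φ hq hq_surj hφ
  obtain ⟨ψ, hψ⟩ := Module.projective_lifting_property (hq.component (-l))
    (hφ.component (-l) ∘ₗ hatUnit L hd l) (hq_surj (-l))
  have q_apply_ψ (x : L) : q (-l) (ψ x) = φ (-l) (hatUnit L hd l x) := LinearMap.congr_fun hψ x
  refine ⟨_, isGradedLinear_shiftHatLift hd l ψ, fun i x => ?_⟩
  induction x using shift_hat_induction with
  | zero => simp only [map_zero]
  | act_unit x a => rw [shiftHatLift_act_hatUnit, hq.map_act, hφ.map_act, q_apply_ψ]
  | add x y hx hy => simp only [map_add, hx, hy]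

theorem isFiniteProjective_shift_hat (hpos : ∀ i : ℤ, i < 0 → 𝒜 i = ⊥)
    [Module.Projective (𝒜 0)ᵐᵒᵖ L] (hL : IsFiniteLength (𝒜 0)ᵐᵒᵖ L) :
    IsFiniteProjective.{uk, u, u, w₂} (shift l (hat D L hd)) where
  projective := isGradedProjective_shift_hat hd l
  bounded_below := ⟨-l, fun _ => subsingleton_shift_hat hd l hpos⟩
  head_bounded_above := ⟨-l + 1, fun _ hi => subsingleton_head_shift_hat hd l (by omega)⟩
  head_finiteLength i := by
    rcases lt_trichotomy i (-l) with hi | rfl | hi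
    · have := subsingleton_shift_hat (L := L) hd l hpos hi
      have := (Sub.mkQ_surjective (rad (shift l (hat D L hd))) i).subsingleton
      exact .of_subsingleton
    · let mkQ := (Sub.mkQ (rad (shift l (hat D L hd)))).isGradedLinear.component (-l)
      exact hL.of_surjective (f := mkQ ∘ₗ hatUnit L hd l)
        ((Sub.mkQ_surjective _ (-l)).comp (hatUnit_surjective hd l))
    · have := subsingleton_head_shift_hat (L := L) hd l hi
      exact .of_subsingleton

end ShiftedHat

section Filtration

variable {M : DGModule.{uk, u, w} D}

theorem Iso.inv_hom_apply {M : DGModule.{uk, u, w₁} D} {N : DGModule.{uk, u, w₂} D} (e : Iso M N)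
    {i : ℤ} (x : M.X i) : e.inv.toFun i (e.hom.toFun i x) = x :=
  DFunLike.congr_fun (congrFun (congrArg Hom.toFun e.hom_inv_id) i) x

theorem IsFiniteProjective.of_subquotient {U V : Sub M} (hUV : U ≤ V) {P : DGModule.{uk, u, w₁} D}
    (e : Iso (Sub.subquotient U V) P) (hU : IsFiniteProjective.{uk, u, w, w} U.toDGModule)
    (hP : IsFiniteProjective.{uk, u, w₁, w} P) :
    IsFiniteProjective.{uk, u, w, w} V.toDGModule := by
  let π := (U.restrict V).mkQ
  obtain ⟨σ, hσ, hπσ⟩ := hP.projective π.toFun e.inv.toFun π.isGradedLinear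
    (U.restrict V).mkQ_surjective e.inv.isGradedLinear
  let β := (e.hom.comp π).toFun
  have sub_mem (i : ℤ) (x : V.toDGModule.X i) : (x - σ i (β i x)).1 ∈ U.carrier i := by
    have : π.toFun i (x - σ i (β i x)) = 0 := by
      rw [map_sub, hπσ, sub_eq_zero]
      exact (e.inv_hom_apply (π.toFun i x)).symm
    exact (U.restrict V).mkQ_eq_zero_iff.1 this
  let α (i : ℤ) : U.toDGModule.X i →+ V.toDGModule.X i := AddSubgroup.inclusion (hUV i)
  let ρ (i : ℤ) : V.toDGModule.X i →+ U.toDGModule.X i :=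
    (V.subtype.toFun i).comp (AddMonoidHom.id (V.toDGModule.X i) - (σ i).comp (β i))
      |>.codRestrict (U.carrier i) (sub_mem i)
  have hβ : IsGradedLinear β := (e.hom.comp π).isGradedLinear
  have hα : IsGradedLinear α := ⟨fun _ _ _ => rfl⟩
  have hρ : IsGradedLinear ρ := ⟨fun h x a => Subtype.ext
    ((V.subtype.isGradedLinear.comp (IsGradedLinear.id.sub (hσ.comp hβ))).map_act h x a)⟩
  exact .of_add_eq_id hU hP hα hρ hσ hβ fun i x => sub_add_cancel x _

theorem IsFiniteProjective.of_filtration {n : ℕ} {F : Fin (n + 1) → Sub M} (hbot : F 0 = ⊥)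
    (htop : F (Fin.last n) = ⊤) (hF : Monotone F)
    (hstep : ∀ i : Fin n, ∃ P : DGModule.{uk, u, w₁} D, IsFiniteProjective.{uk, u, w₁, w} P ∧
      Nonempty (Iso (Sub.subquotient (F i.castSucc) (F i.succ)) P)) :
    IsFiniteProjective.{uk, u, w, w} M := by
  have projective_steps (i : Fin (n + 1)) : IsFiniteProjective.{uk, u, w, w} (F i).toDGModule := by
    induction i using Fin.induction with
    | zero =>
      rw [hbot]
      exact .of_subsingleton fun i => (inferInstance : Subsingleton (⊥ : AddSubgroup (M.X i)))
    | succ i ih =>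
      obtain ⟨P, hP, ⟨e⟩⟩ := hstep i
      exact .of_subquotient (hF i.castSucc_le_succ) e ih hP
  have htop' := htop ▸ projective_steps (Fin.last n)
  let ρ (i : ℤ) : M.X i →+ (⊤ : Sub M).toDGModule.X i :=
    (AddMonoidHom.id (M.X i)).codRestrict ⊤ fun _ => trivial
  exact .of_add_eq_id htop' htop' (⊤ : Sub M).subtype.isGradedLinear
    (ρ := ρ) ⟨fun _ _ _ => rfl⟩ .zero .zero fun i x => add_zero x

end Filtration

section Fitting

variable {M : DGModule.{uk, u, w} D}

theorem Hom.pow_add_apply (f : Hom M M) (m n : ℕ) (i : ℤ) (x : M.X i) :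
    (f ^ (m + n)).toFun i x = (f ^ m).toFun i ((f ^ n).toFun i x) := by
  rw [pow_add]
  rfl

theorem exists_forall_pow_apply_eq (f : Hom M M)
    (hf : IsStronglyPiRegular (Hom.toGradedEnd M f)) :
    ∃ N : ℕ, ∀ n ≥ N, ∀ p, ∃ y z : ∀ i, M.X i →+ M.X i,
      (∀ i x, (f ^ n).toFun i x = (f ^ (n + p)).toFun i (y i x)) ∧
      ∀ i x, (f ^ n).toFun i x = z i ((f ^ (n + p)).toFun i x) := by
  obtain ⟨N, hN⟩ := hf.exists_forall_pow_eq
  refine ⟨N, fun n hn p => ?_⟩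
  obtain ⟨⟨y, hy⟩, z, hz⟩ := hN n hn p
  rw [← map_pow, ← map_pow] at hy hz
  exact ⟨y.1, z.1, fun i x => DFunLike.congr_fun (congrFun (congrArg Subtype.val hy) i) x,
    fun i x => DFunLike.congr_fun (congrFun (congrArg Subtype.val hz) i) x⟩

theorem isDirectSum_ker_im_pow {f : Hom M M} {n : ℕ} {y z : ∀ i, M.X i →+ M.X i}
    (hy : ∀ i x, (f ^ n).toFun i x = (f ^ (n + n)).toFun i (y i x))
    (hz : ∀ i x, (f ^ n).toFun i x = z i ((f ^ (n + n)).toFun i x)) :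
    Sub.IsDirectSum (f ^ n).ker (f ^ n).im := by
  refine fun i => ⟨AddSubgroup.disjoint_def.2 ?_, codisjoint_iff_le_sup.2 fun x _ => ?_⟩
  · rintro _ (hx : (f ^ n).toFun i _ = 0) ⟨x, rfl⟩
    rw [hz, Hom.pow_add_apply, hx, map_zero]
  · have sub_mem_ker : (f ^ n).toFun i (x - (f ^ n).toFun i (y i x)) = 0 := by
      rw [map_sub, ← Hom.pow_add_apply, ← hy, sub_self]
    exact AddSubgroup.mem_sup.2 ⟨_, sub_mem_ker, _, ⟨y i x, rfl⟩, sub_add_cancel _ _⟩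

theorem exists_fitting_of_isStronglyPiRegular (f : Hom M M)
    (hf : IsStronglyPiRegular (Hom.toGradedEnd M f)) :
    ∃ N : ℕ, ∀ n : ℕ, N ≤ n →
      (f ^ n).ker = (f ^ (n + 1)).ker ∧
      (f ^ n).im = (f ^ (n + 1)).im ∧
      Sub.IsDirectSum (f ^ n).ker (f ^ n).im := by
  obtain ⟨N, hN⟩ := exists_forall_pow_apply_eq f hf
  refine ⟨N, fun n hn => ?_⟩
  obtain ⟨y, z, hy, hz⟩ := hN n hn 1
  obtain ⟨y', z', hy', hz'⟩ := hN n hn n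
  refine ⟨Sub.ext (funext fun i => le_antisymm ?_ ?_), Sub.ext (funext fun i => le_antisymm ?_ ?_),
    isDirectSum_ker_im_pow hy' hz'⟩
  · intro x (hx : (f ^ n).toFun i x = 0)
    change (f ^ (n + 1)).toFun i x = 0
    rw [add_comm, f.pow_add_apply, hx, map_zero]
  · intro x (hx : (f ^ (n + 1)).toFun i x = 0)
    change (f ^ n).toFun i x = 0
    rw [hz, hx, map_zero]
  · rintro _ ⟨x, rfl⟩
    exact ⟨y i x, (hy i x).symm⟩
  · rintro _ ⟨x, rfl⟩
    exact ⟨f.toFun i x, by rw [f.pow_add_apply, pow_one]⟩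

end Fitting

end DGModule

theorem proposition8p5_general {k : Type uk} [CommRing k] {A : Type u} [Ring A] [Algebra k A]
    {𝒜 : ℤ → Submodule k A} [GradedAlgebra 𝒜] (D : DGAlgebra 𝒜)
    (hpos : ∀ i : ℤ, i < 0 → 𝒜 i = ⊥) (hd : ∀ a ∈ 𝒜 0, D.d a = 0) (M : DGModule.{uk, u, w} D)
    {m : ℕ} {F : Fin (m + 1) → DGModule.Sub M} {l : Fin m → ℤ} (hbot : F 0 = ⊥)
    (htop : F (Fin.last m) = ⊤) (hF : Monotone F)
    (hstep : ∀ i : Fin m, ∃ (L : Type u) (_ : AddCommGroup L) (_ : Module (𝒜 0)ᵐᵒᵖ L),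
      Module.Projective (𝒜 0)ᵐᵒᵖ L ∧ IsFiniteLength (𝒜 0)ᵐᵒᵖ L ∧
      Nonempty (DGModule.Iso (DGModule.Sub.subquotient (F i.castSucc) (F i.succ))
        (DGModule.shift (l i) (DGModule.hat D L hd))))
    (f : DGModule.Hom M M) :
    ∃ N : ℕ, ∀ n : ℕ, N ≤ n →
      (f ^ n).ker = (f ^ (n + 1)).ker ∧
      (f ^ n).im = (f ^ (n + 1)).im ∧
      DGModule.Sub.IsDirectSum (f ^ n).ker (f ^ n).im := by
  have hM : DGModule.IsFiniteProjective.{uk, u, w, w} M :=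
    .of_filtration hbot htop hF fun i => by
      obtain ⟨L, _, _, _, hL, e⟩ := hstep i
      exact ⟨_, DGModule.isFiniteProjective_shift_hat hd (l i) hpos hL, e⟩
  exact DGModule.exists_fitting_of_isStronglyPiRegular f (hM.isStronglyPiRegular hpos _)

theorem proposition8p5 {k : Type uk} [CommRing k] {A : Type u} [Ring A] [Algebra k A]
    {𝒜 : ℤ → Submodule k A} [GradedAlgebra 𝒜] (D : DGAlgebra 𝒜) (hD : D.IsAdmissible)
    (M : DGModule.{uk, u, w} D) (hM : DGModule.IsFilt hD M) (f : DGModule.Hom M M) :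
    ∃ N : ℕ, ∀ n : ℕ, N ≤ n →
      (f ^ n).ker = (f ^ (n + 1)).ker ∧
      (f ^ n).im = (f ^ (n + 1)).im ∧
      DGModule.Sub.IsDirectSum (f ^ n).ker (f ^ n).im := by
  have := hD.semisimple
  obtain ⟨n, F, l, hbot, htop, hF, -, hstep⟩ := hM
  refine proposition8p5_general D hD.pos_graded hD.d_zero M (l := l) hbot htop hF (fun i => ?_) f
  obtain ⟨L, _, _, _, e⟩ := hstep i
  exact ⟨L, _, _, Module.projective_of_isSemisimpleRing _ _,
    isFiniteLength_iff_isNoetherian_isArtinian.2 ⟨inferInstance, inferInstance⟩, e⟩
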